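/- Let $m\ge 1$ and $d_1,\dots,d_m\ge 2$ be integers. For $i=1,\dots,m$ let $C_i\subset\mathbb C^{k_i}$ and let $(P_{i,c})_{c\in C_i}$ be a family of complex polynomials in one variable, each of degree exactly $d_i$, whose coefficients depend continuously on $c\in C_i$. Assume that $C=C_1\times\dots\times C_m\subset\mathbb C^{k}$, $k=k_1+\dots+k_m$, is compact. For $a=(a_1,\dots,a_m)$ with $a_i\in\mathbb C$, $0<|a_i|<1$, and for $c=(c_1,\dots,c_m)\in C$, let $g_{a,c}=g_1\circ\dots\circ g_m:\mathbb C^2\to\mathbb C^2$, where $$g_i(z,w)=(w,\;P_{i,c_i}(w)+a_i z),$$ put $|a|:=|a_1\cdots a_m|$, and let $K^-_{a,c}$ be the set of all $p\in\mathbb C^2$ whose backward orbit $\{g_{a,c}^{-n}(p):n\ge 0\}$ is bounded. Then for every $\varepsilon>0$ there is $a_0>0$ such that, for all $a=(a_1,\dots,a_m)$ with $0<|a_i|<1$ for every $i$ and $|a|<a_0$, and for all $c\in C$, $$\dim_H K^-_{a,c}<2+\varepsilon,$$ where $\dim_H$ is the Hausdorff dimension. -/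

import Mathlib

open scoped ENNReal Polynomial

/-- The generalized Hénon mapping `(z, w) ↦ (w, P(w) + a z)`, where `a` is a non-zero complex
number, as a bijection of `ℂ²`; its inverse is `(z, w) ↦ (a⁻¹ (w - P(z)), z)`. -/
noncomputable def genHenon (a : ℂˣ) (P : ℂ[X]) : Equiv.Perm (ℂ × ℂ) where
  toFun p := (p.2, P.eval p.2 + (a : ℂ) * p.1)
  invFun p := ((a : ℂ)⁻¹ * (p.2 - P.eval p.1), p.1)
  left_inv p := by
    ext <;> simp
  right_inv p := by
    ext <;> simp

/-- The composition `g₁ ∘ ⋯ ∘ g_m` of the generalized Hénon mappings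
`g_i (z, w) = (w, P_i(w) + a_i z)`. (Multiplication in `Equiv.Perm` is composition, with the
right factor applied first.) -/
noncomputable def genHenonComp {m : ℕ} (a : Fin m → ℂˣ) (P : Fin m → ℂ[X]) :
    Equiv.Perm (ℂ × ℂ) :=
  (List.ofFn fun i => genHenon (a i) (P i)).prod

/-- The set `K⁻` of a bijection `g` of `ℂ²`: the points whose backward orbit
`{g⁻ⁿ(p) : n = 0, 1, 2, …}` is bounded. -/
def setKMinus (g : Equiv.Perm (ℂ × ℂ)) : Set (ℂ × ℂ) :=
  {p | Bornology.IsBounded (Set.range fun n : ℕ => (⇑g.symm)^[n] p)}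

section HenonDimension

open MeasureTheory Metric

/-! Let s = 2 + ε/2. A Hénon map shrinks the first coordinate by |a|, while the second is distorted
by a bounded factor L on a fixed bidisc. A set of diameter r cut into about |a|⁻² pieces of width
|a|r in the second coordinate therefore has image pieces of diameter O(|a|r), so s-content shrinks
by a factor O(|a|^(s-2)) (`hausdorffContent_genHenon_image_le_ediam`). These factors multiply along
the composition, so only the product of the a_i must be small.

The part W of K⁻ in the bidisc is the image under g of a subset of itself. Its content is finite and
at most a factor < 1 times itself, hence zero, so dim W ≤ s. Backward orbits in K⁻ enter the bidisc,
so K⁻ is covered by countably many smooth images of W (`dimH_setKMinus_henonList_le`). Compactness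
of C makes all constants uniform (`exists_henonBounds`). -/

/-- The `s`-dimensional Hausdorff content, as an outer measure. -/
noncomputable def hausdorffContent (X : Type*) [EMetricSpace X] (s : ℝ) (hs : 0 < s) :
    OuterMeasure X :=
  OuterMeasure.ofFunction (fun U => ediam U ^ s) (by simp [hs])

/-! ### Hausdorff content and dimension -/

section Content

variable {X : Type*} [EMetricSpace X] {s : ℝ} (hs : 0 < s)

theorem hausdorffContent_le_ediam_rpow (A : Set X) :
    hausdorffContent X s hs A ≤ ediam A ^ s :=
  OuterMeasure.ofFunction_le A

/-- A cover with small total ∑ diam^s has each diameter small too, so zero content already forces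
zero Hausdorff measure. -/
theorem dimH_le_of_hausdorffContent_eq_zero {A : Set X} (h : hausdorffContent X s hs A = 0) :
    dimH A ≤ ENNReal.ofReal s := by
  borelize X
  have key : μH[s] A = 0 := by
    rw [Measure.hausdorffMeasure_apply]
    refine le_antisymm (iSup₂_le fun r hr => ?_) zero_le
    refine ENNReal.le_of_forall_pos_le_add fun η hη _ => ?_
    rw [zero_add]
    have hpos : 0 < min (η : ℝ≥0∞) (r ^ s) :=
      lt_min (by exact_mod_cast hη) (ENNReal.rpow_pos_of_nonneg hr hs.le)
    rw [← h, hausdorffContent, OuterMeasure.ofFunction_apply] at hpos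
    obtain ⟨t, ht⟩ := iInf_lt_iff.1 hpos
    obtain ⟨hAt, hsum⟩ := iInf_lt_iff.1 ht
    refine iInf₂_le_of_le t hAt (iInf_le_of_le (fun n => ?_) ?_)
    · refine (ENNReal.rpow_le_rpow_iff hs).1 ?_
      exact (ENNReal.le_tsum (f := fun n => ediam (t n) ^ s) n).trans
        (hsum.le.trans (min_le_right _ _))
    · refine le_trans (ENNReal.tsum_le_tsum fun n => iSup_le fun _ => le_rfl) ?_
      exact hsum.le.trans (min_le_left _ _)
  have := dimH_le_of_hausdorffMeasure_ne_top (d := s.toNNReal) (s := A)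
    (by rw [Real.coe_toNNReal s hs.le, key]; simp)
  simpa [ENNReal.ofReal] using this

/-- If the image of each subset `B` of `A` has content at most `q * (ediam B) ^ s`, then the image of `A`
has content at most `q` times that of `A`. -/
theorem hausdorffContent_image_le {f : X → X} {A : Set X} {q : ℝ≥0∞} (hq : q ≠ 0) (hq' : q ≠ ∞)
    (h : ∀ B ⊆ A, hausdorffContent X s hs (f '' B) ≤ q * ediam B ^ s) :
    hausdorffContent X s hs (f '' A) ≤ q * hausdorffContent X s hs A := by
  conv_rhs => rw [hausdorffContent, OuterMeasure.ofFunction_apply]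
  simp only [ENNReal.mul_iInf_of_ne hq hq']
  refine le_iInf₂ fun t ht => ?_
  have hcov : f '' A ⊆ ⋃ n, f '' (A ∩ t n) := by
    rw [← Set.image_iUnion, ← Set.inter_iUnion, Set.inter_eq_self_of_subset_left ht]
  refine (measure_mono hcov).trans ((measure_iUnion_le _).trans ?_)
  rw [← ENNReal.tsum_mul_left]
  refine ENNReal.tsum_le_tsum fun n => (h _ Set.inter_subset_left).trans ?_
  gcongr
  exact Set.inter_subset_right

end Content

/-! ### Contraction of content by one Hénon map -/

theorem abs_sub_le_of_floor_div_eq {x y h : ℝ} (hh : 0 < h) (hx : 0 ≤ x) (hy : 0 ≤ y)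
    (hxy : ⌊x / h⌋₊ = ⌊y / h⌋₊) : |x - y| ≤ h := by
  have hx1 := Nat.floor_le (div_nonneg hx hh.le)
  have hx2 := Nat.lt_floor_add_one (x / h)
  have hy1 := Nat.floor_le (div_nonneg hy hh.le)
  have hy2 := Nat.lt_floor_add_one (y / h)
  rw [hxy] at hx1 hx2
  have h1 : x / h - y / h ≤ 1 := by linarith
  have h2 : y / h - x / h ≤ 1 := by linarith
  rw [← sub_div, div_le_one hh] at h1 h2
  exact abs_sub_le_iff.2 ⟨h1, h2⟩

@[simp]
theorem genHenon_apply (a : ℂˣ) (P : ℂ[X]) (p : ℂ × ℂ) :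
    genHenon a P p = (p.2, P.eval p.2 + (a : ℂ) * p.1) := rfl

@[simp]
theorem genHenon_symm_apply (a : ℂˣ) (P : ℂ[X]) (p : ℂ × ℂ) :
    (genHenon a P).symm p = ((a : ℂ)⁻¹ * (p.2 - P.eval p.1), p.1) := rfl

/-- On a set whose second coordinates are `δ`-close with `δ` comparable to `‖a‖` times the diameter,
a generalized Hénon mapping contracts the diameter by a factor comparable to `‖a‖`. -/
theorem dist_genHenon_le (a : ℂˣ) (P : ℂ[X]) {L r : ℝ} (hL : 0 ≤ L) (hr : 0 ≤ r)
    {p q : ℂ × ℂ}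
    (hP : ‖P.eval p.2 - P.eval q.2‖ ≤ L * ‖p.2 - q.2‖) (hpq : ‖p.2 - q.2‖ ≤ ‖(a : ℂ)‖ * r)
    (hz : dist p q ≤ r) :
    dist (genHenon a P p) (genHenon a P q) ≤ (L + 1) * ‖(a : ℂ)‖ * r := by
  have har : 0 ≤ ‖(a : ℂ)‖ * r := by positivity
  have hz1 : ‖p.1 - q.1‖ ≤ r := by
    rw [← dist_eq_norm]; exact (le_max_left _ _).trans hz
  rw [Prod.dist_eq, dist_eq_norm, dist_eq_norm]
  refine max_le ?_ ?_
  · simp only [genHenon_apply]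
    nlinarith [mul_nonneg hL har]
  · simp only [genHenon_apply]
    calc ‖P.eval p.2 + (a : ℂ) * p.1 - (P.eval q.2 + (a : ℂ) * q.1)‖
        = ‖(P.eval p.2 - P.eval q.2) + (a : ℂ) * (p.1 - q.1)‖ := by ring_nf
      _ ≤ ‖P.eval p.2 - P.eval q.2‖ + ‖(a : ℂ) * (p.1 - q.1)‖ := norm_add_le _ _
      _ ≤ L * (‖(a : ℂ)‖ * r) + ‖(a : ℂ)‖ * r := by
          rw [norm_mul]
          gcongr
          exact hP.trans (by gcongr)
      _ = (L + 1) * ‖(a : ℂ)‖ * r := by ring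

theorem hausdorffContent_genHenon_image_le_ediam {s : ℝ} (hs : 0 < s) (a : ℂˣ)
    (ha : ‖(a : ℂ)‖ ≤ 1) (P : ℂ[X]) {L : ℝ} (hL : 0 ≤ L) {B : Set (ℂ × ℂ)}
    (hB : Bornology.IsBounded B)
    (hP : ∀ p ∈ B, ∀ q ∈ B, ‖P.eval p.2 - P.eval q.2‖ ≤ L * ‖p.2 - q.2‖) :
    hausdorffContent (ℂ × ℂ) s hs (genHenon a P '' B) ≤
      ENNReal.ofReal (25 * (L + 1) ^ s * ‖(a : ℂ)‖ ^ (s - 2)) * ediam B ^ s := by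
  have ha0 : 0 < ‖(a : ℂ)‖ := norm_pos_iff.2 a.ne_zero
  rcases B.subsingleton_or_nontrivial with hsub | hnt
  · refine (hausdorffContent_le_ediam_rpow hs _).trans ?_
    rw [(hsub.image _).ediam_eq, ENNReal.zero_rpow_of_pos hs]
    exact zero_le
  set r := Metric.diam B with hr
  have hr0 : 0 < r := Metric.diam_pos hnt hB
  have hBr : ediam B = ENNReal.ofReal r := (ENNReal.ofReal_toReal hB.ediam_ne_top).symm
  obtain ⟨p₀, hp₀⟩ := hnt.nonempty
  have hdist : ∀ p ∈ B, ∀ q ∈ B, dist p q ≤ r := fun p hp q hq => Metric.dist_le_diam_of_mem hB hp hq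
  -- Half of |a|r, since the real and imaginary deviations in a grid cell add up.
  set h := ‖(a : ℂ)‖ * r / 2 with hh
  have hh0 : 0 < h := by positivity
  -- Each real coordinate ranges over an interval of length 2r, and 2r/h = 4/|a|; the extra cell
  -- holds the right endpoint.
  set n := ⌊4 / ‖(a : ℂ)‖⌋₊ + 1 with hn
  have hn5 : (n : ℝ) ≤ 5 / ‖(a : ℂ)‖ := by
    have h1 := Nat.floor_le (a := 4 / ‖(a : ℂ)‖) (by positivity)
    have h2 : 1 ≤ 1 / ‖(a : ℂ)‖ := (one_le_div ha0).2 ha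
    have h3 : (5 : ℝ) / ‖(a : ℂ)‖ = 4 / ‖(a : ℂ)‖ + 1 / ‖(a : ℂ)‖ := by ring
    rw [hn, h3]
    push_cast
    linarith
  have hnorm : ∀ p ∈ B, ‖p.2 - p₀.2‖ ≤ r := fun p hp => by
    rw [← dist_eq_norm]; exact (le_max_right _ _).trans (hdist p hp p₀ hp₀)
  have hre : ∀ p ∈ B, |p.2.re - p₀.2.re| ≤ r := fun p hp => by
    rw [← Complex.sub_re]; exact (Complex.abs_re_le_norm _).trans (hnorm p hp)
  have him : ∀ p ∈ B, |p.2.im - p₀.2.im| ≤ r := fun p hp => by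
    rw [← Complex.sub_im]; exact (Complex.abs_im_le_norm _).trans (hnorm p hp)
  have hfl : ∀ x : ℝ, |x| ≤ r → ⌊(x + r) / h⌋₊ < n := fun x hx => by
    refine Nat.lt_succ_of_le (Nat.floor_le_floor ?_)
    rw [div_le_div_iff₀ hh0 ha0, hh]
    nlinarith [(abs_le.1 hx).2]
  let T : Fin n × Fin n → Set (ℂ × ℂ) := fun ij =>
    {p ∈ B | ⌊(p.2.re - p₀.2.re + r) / h⌋₊ = ij.1 ∧ ⌊(p.2.im - p₀.2.im + r) / h⌋₊ = ij.2}
  have hcov : genHenon a P '' B ⊆ ⋃ ij, genHenon a P '' T ij := by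
    rw [← Set.image_iUnion]
    refine Set.image_mono fun p hp => Set.mem_iUnion.2 ?_
    exact ⟨(⟨_, hfl _ (hre p hp)⟩, ⟨_, hfl _ (him p hp)⟩), hp, rfl, rfl⟩
  have hT : ∀ ij, hausdorffContent (ℂ × ℂ) s hs (genHenon a P '' T ij) ≤
      ENNReal.ofReal ((L + 1) * ‖(a : ℂ)‖ * r) ^ s := fun ij => by
    refine (hausdorffContent_le_ediam_rpow hs _).trans ?_
    gcongr
    refine ediam_image_le_iff.2 fun p hp q hq => ?_
    rw [edist_dist]
    refine ENNReal.ofReal_le_ofReal (dist_genHenon_le a P hL hr0.le (hP p hp.1 q hq.1) ?_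
      (hdist p hp.1 q hq.1))
    have e1 := abs_sub_le_of_floor_div_eq hh0 (by linarith [(abs_le.1 (hre p hp.1)).1])
      (by linarith [(abs_le.1 (hre q hq.1)).1]) (hp.2.1.trans hq.2.1.symm)
    have e2 := abs_sub_le_of_floor_div_eq hh0 (by linarith [(abs_le.1 (him p hp.1)).1])
      (by linarith [(abs_le.1 (him q hq.1)).1]) (hp.2.2.trans hq.2.2.symm)
    have e3 := Complex.norm_le_abs_re_add_abs_im (p.2 - q.2)
    rw [Complex.sub_re, Complex.sub_im] at e3
    ring_nf at e1 e2
    rw [hh] at e1 e2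
    ring_nf at e1 e2 e3 ⊢
    linarith
  calc hausdorffContent (ℂ × ℂ) s hs (genHenon a P '' B)
      ≤ ∑ ij, hausdorffContent (ℂ × ℂ) s hs (genHenon a P '' T ij) :=
        (measure_mono hcov).trans (measure_iUnion_fintype_le _ _)
    _ ≤ ∑ _ij : Fin n × Fin n, ENNReal.ofReal ((L + 1) * ‖(a : ℂ)‖ * r) ^ s :=
        Finset.sum_le_sum fun ij _ => hT ij
    _ = ENNReal.ofReal ((n : ℝ) ^ 2 * ((L + 1) * ‖(a : ℂ)‖ * r) ^ s) := by
        rw [Finset.sum_const, Finset.card_univ, Fintype.card_prod, Fintype.card_fin, nsmul_eq_mul,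
          ENNReal.ofReal_rpow_of_nonneg (by positivity) hs.le, ENNReal.ofReal_mul (by positivity)]
        congr 1
        rw [← Nat.cast_pow, ENNReal.ofReal_natCast, sq]
    _ ≤ ENNReal.ofReal (25 * (L + 1) ^ s * ‖(a : ℂ)‖ ^ (s - 2) * r ^ s) := by
        refine ENNReal.ofReal_le_ofReal ?_
        rw [Real.mul_rpow (by positivity) hr0.le, Real.mul_rpow (by positivity) ha0.le,
          Real.rpow_sub ha0, Real.rpow_two]
        calc (n : ℝ) ^ 2 * ((L + 1) ^ s * ‖(a : ℂ)‖ ^ s * r ^ s)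
            ≤ (5 / ‖(a : ℂ)‖) ^ 2 * ((L + 1) ^ s * ‖(a : ℂ)‖ ^ s * r ^ s) := by gcongr
          _ = _ := by field_simp; norm_num
    _ = _ := by
        rw [ENNReal.ofReal_mul (by positivity), hBr, ENNReal.ofReal_rpow_of_nonneg hr0.le hs.le]

/-! ### Filtration of ℂ² by a bidisc -/

/-- Bounds for a pair `(a, P)` which make the bidisc of radius `R` a filtration bidisc of the
generalized Hénon mapping `genHenon a P`, with `L` a Lipschitz constant of `P` on the disc. -/
structure HenonBounds (R L : ℝ) (x : ℂˣ × ℂ[X]) : Prop where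
  norm_le_one : ‖(x.1 : ℂ)‖ ≤ 1
  escape : ∀ w : ℂ, R ≤ ‖w‖ → 3 * ‖w‖ ≤ ‖x.2.eval w‖
  lipschitz : ∀ w w' : ℂ, ‖w‖ ≤ R → ‖w'‖ ≤ R → ‖x.2.eval w - x.2.eval w'‖ ≤ L * ‖w - w'‖

/-- The composition of the generalized Hénon mappings in a list, the last one applied first. -/
noncomputable def henonList (l : List (ℂˣ × ℂ[X])) : Equiv.Perm (ℂ × ℂ) :=
  (l.map fun x => genHenon x.1 x.2).prod

theorem henonList_nil : henonList [] = 1 := rfl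

theorem henonList_cons (x : ℂˣ × ℂ[X]) (l : List (ℂˣ × ℂ[X])) :
    henonList (x :: l) = genHenon x.1 x.2 * henonList l := by
  simp [henonList]

theorem henonList_cons_apply (x : ℂˣ × ℂ[X]) (l : List (ℂˣ × ℂ[X])) (p : ℂ × ℂ) :
    henonList (x :: l) p = genHenon x.1 x.2 (henonList l p) := by
  rw [henonList_cons, Equiv.Perm.mul_apply]

theorem henonList_cons_symm_apply (x : ℂˣ × ℂ[X]) (l : List (ℂˣ × ℂ[X])) (p : ℂ × ℂ) :
    (henonList (x :: l)).symm p = (henonList l).symm ((genHenon x.1 x.2).symm p) := by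
  rw [henonList_cons]; rfl

/-- The bidisc of radius `R`. -/
def bidisc (R : ℝ) : Set (ℂ × ℂ) := {p | ‖p.1‖ ≤ R ∧ ‖p.2‖ ≤ R}

/-- The part of the complement of the bidisc where the second coordinate dominates. -/
def escapeForward (R : ℝ) : Set (ℂ × ℂ) := {p | R < ‖p.2‖ ∧ ‖p.1‖ ≤ ‖p.2‖}

/-- The part of the complement of the bidisc where the first coordinate dominates. -/
def escapeBackward (R : ℝ) : Set (ℂ × ℂ) := {p | R < ‖p.1‖ ∧ ‖p.2‖ ≤ ‖p.1‖}

theorem isBounded_bidisc (R : ℝ) : Bornology.IsBounded (bidisc R) := by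
  refine (Metric.isBounded_closedBall (x := (0 : ℂ × ℂ)) (r := R)).subset fun p hp => ?_
  rw [mem_closedBall_zero_iff]
  exact max_le hp.1 hp.2

theorem mem_bidisc_or_escape (R : ℝ) (p : ℂ × ℂ) :
    p ∈ bidisc R ∨ p ∈ escapeForward R ∨ p ∈ escapeBackward R := by
  simp only [bidisc, escapeForward, escapeBackward, Set.mem_ofPred_eq]
  grind

section Dynamics

variable {R L : ℝ} {x : ℂˣ × ℂ[X]} {l : List (ℂˣ × ℂ[X])}

/-- The polynomial term expands by 3 and the linear term costs at most 1, leaving a factor 2. -/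
theorem HenonBounds.forward (h : HenonBounds R L x) {p : ℂ × ℂ} (hp : p ∈ escapeForward R) :
    genHenon x.1 x.2 p ∈ escapeForward R ∧ 2 * ‖p.2‖ ≤ ‖(genHenon x.1 x.2 p).2‖ := by
  obtain ⟨hp1, hp2⟩ := hp
  have h0 := norm_nonneg p.2
  have key : 2 * ‖p.2‖ ≤ ‖(genHenon x.1 x.2 p).2‖ := by
    have h1 := h.escape p.2 hp1.le
    have h2 : ‖(x.1 : ℂ) * p.1‖ ≤ ‖p.2‖ := by
      rw [norm_mul]
      exact (mul_le_of_le_one_left (norm_nonneg _) h.norm_le_one).trans hp2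
    have h3 := norm_sub_le_norm_add (x.2.eval p.2) ((x.1 : ℂ) * p.1)
    simp only [genHenon_apply]
    linarith
  refine ⟨⟨by linarith, ?_⟩, key⟩
  simp only [genHenon_apply] at key ⊢
  linarith

theorem HenonBounds.backward (h : HenonBounds R L x) {p : ℂ × ℂ} (hp : p ∈ escapeBackward R) :
    (genHenon x.1 x.2).symm p ∈ escapeBackward R ∧
      2 * ‖p.1‖ ≤ ‖((genHenon x.1 x.2).symm p).1‖ := by
  obtain ⟨hp1, hp2⟩ := hp
  have h0 := norm_nonneg p.1
  have key : 2 * ‖p.1‖ ≤ ‖((genHenon x.1 x.2).symm p).1‖ := by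
    have h1 := h.escape p.1 hp1.le
    have h2 : 1 ≤ ‖(x.1 : ℂ)⁻¹‖ := by
      rw [norm_inv]
      exact (one_le_inv₀ (norm_pos_iff.2 x.1.ne_zero)).2 h.norm_le_one
    have h3 := norm_sub_norm_le (x.2.eval p.1) p.2
    rw [norm_sub_rev] at h3
    simp only [genHenon_symm_apply, norm_mul]
    have h4 := le_mul_of_one_le_left (norm_nonneg (p.2 - x.2.eval p.1)) h2
    linarith
  refine ⟨⟨by linarith, ?_⟩, key⟩
  simp only [genHenon_symm_apply] at key ⊢
  linarith

theorem henonList_forward (hl : ∀ x ∈ l, HenonBounds R L x) {p : ℂ × ℂ}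
    (hp : p ∈ escapeForward R) :
    henonList l p ∈ escapeForward R ∧ 2 ^ l.length * ‖p.2‖ ≤ ‖(henonList l p).2‖ := by
  induction l with
  | nil => simpa [henonList_nil] using hp
  | cons x l ih =>
    obtain ⟨h1, h2⟩ := ih fun y hy => hl y (List.mem_cons_of_mem _ hy)
    obtain ⟨h3, h4⟩ := (hl x List.mem_cons_self).forward h1
    rw [henonList_cons_apply, List.length_cons, pow_succ]
    exact ⟨h3, by linarith⟩

theorem henonList_backward (hl : ∀ x ∈ l, HenonBounds R L x) {p : ℂ × ℂ}
    (hp : p ∈ escapeBackward R) :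
    (henonList l).symm p ∈ escapeBackward R ∧
      2 ^ l.length * ‖p.1‖ ≤ ‖((henonList l).symm p).1‖ := by
  induction l generalizing p with
  | nil => exact ⟨hp, by simp [henonList_nil, Equiv.Perm.one_def]⟩
  | cons x l ih =>
    obtain ⟨h3, h4⟩ := (hl x List.mem_cons_self).backward hp
    obtain ⟨h1, h2⟩ := ih (fun y hy => hl y (List.mem_cons_of_mem _ hy)) h3
    rw [henonList_cons_symm_apply, List.length_cons, pow_succ]
    refine ⟨h1, le_trans ?_ h2⟩
    rw [mul_assoc]
    gcongr

theorem disjoint_bidisc_escapeForward {p : ℂ × ℂ} (hp : p ∈ bidisc R) : p ∉ escapeForward R :=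
  fun h => h.1.not_ge hp.2

theorem disjoint_bidisc_escapeBackward {p : ℂ × ℂ} (hp : p ∈ bidisc R) : p ∉ escapeBackward R :=
  fun h => h.1.not_ge hp.1

/-- A composition of generalized Hénon mappings contracts the `s`-dimensional Hausdorff content of
subsets of the bidisc by a factor comparable to the Jacobian to the power `s - 2`. -/
theorem hausdorffContent_henonList_image_le {s : ℝ} (hs : 0 < s) (hL : 0 ≤ L)
    (hl : ∀ x ∈ l, HenonBounds R L x) {A : Set (ℂ × ℂ)} (hA : A ⊆ bidisc R)
    (hA' : henonList l '' A ⊆ bidisc R) :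
    hausdorffContent (ℂ × ℂ) s hs (henonList l '' A) ≤
      ENNReal.ofReal ((25 * (L + 1) ^ s) ^ l.length * ‖(l.map fun x => (x.1 : ℂ)).prod‖ ^ (s - 2)) *
        hausdorffContent (ℂ × ℂ) s hs A := by
  induction l with
  | nil => simp [henonList_nil]
  | cons x l ih =>
    have hx := hl x List.mem_cons_self
    have hl' : ∀ y ∈ l, HenonBounds R L y := fun y hy => hl y (List.mem_cons_of_mem _ hy)
    have hcomp : henonList (x :: l) '' A = genHenon x.1 x.2 '' (henonList l '' A) := by
      rw [Set.image_image]
      exact Set.image_congr fun p _ => henonList_cons_apply x l p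
    -- An intermediate point outside the bidisc would be trapped outside it, either under the next
    -- map or under the inverses leading back to `A`.
    have hmid : henonList l '' A ⊆ bidisc R := by
      rintro _ ⟨p, hp, rfl⟩
      rcases mem_bidisc_or_escape R (henonList l p) with h | h | h
      · exact h
      · refine absurd (hx.forward h).1 (disjoint_bidisc_escapeForward ?_)
        rw [← henonList_cons_apply]
        exact hA' ⟨p, hp, rfl⟩
      · have := (henonList_backward hl' h).1
        rw [Equiv.symm_apply_apply] at this
        exact absurd this (disjoint_bidisc_escapeBackward (hA hp))
    have ha0 : 0 < ‖(x.1 : ℂ)‖ := norm_pos_iff.2 x.1.ne_zero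
    have hstep := hausdorffContent_image_le hs (f := genHenon x.1 x.2) (A := henonList l '' A)
      (q := ENNReal.ofReal (25 * (L + 1) ^ s * ‖(x.1 : ℂ)‖ ^ (s - 2)))
      (by rw [Ne, ENNReal.ofReal_eq_zero, not_le]; positivity) ENNReal.ofReal_ne_top
      fun B hB => hausdorffContent_genHenon_image_le_ediam hs x.1 hx.norm_le_one x.2 hL
        ((isBounded_bidisc R).subset (hB.trans hmid))
        fun p hp q hq => hx.lipschitz _ _ (hmid (hB hp)).2 (hmid (hB hq)).2
    rw [hcomp]
    refine hstep.trans ((mul_le_mul_right (ih hl' hmid) _).trans (le_of_eq ?_))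
    rw [← mul_assoc, ← ENNReal.ofReal_mul (by positivity), List.map_cons, List.prod_cons, norm_mul,
      Real.mul_rpow (norm_nonneg _) (norm_nonneg _), List.length_cons, pow_succ]
    congr 2
    ring

/-! ### Structure and dimension of K⁻ -/

theorem contDiff_henonList (l : List (ℂˣ × ℂ[X])) : ContDiff ℝ 1 (henonList l) := by
  induction l with
  | nil => exact contDiff_id
  | cons x l ih =>
    have hP : ContDiff ℝ 1 fun w : ℂ => x.2.eval w := by
      have : ContDiff ℂ 1 fun w : ℂ => x.2.eval w := by
        simpa using x.2.contDiff_aeval (𝕜 := ℂ) 1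
      exact this.restrict_scalars ℝ
    have h : ContDiff ℝ 1 (genHenon x.1 x.2) :=
      contDiff_snd.prodMk ((hP.comp contDiff_snd).add (contDiff_const.mul contDiff_fst))
    have hc : ⇑(henonList (x :: l)) = genHenon x.1 x.2 ∘ henonList l :=
      funext fun p => henonList_cons_apply x l p
    rw [hc]
    exact h.comp ih

theorem contDiff_iterate_henonList (l : List (ℂˣ × ℂ[X])) (n : ℕ) :
    ContDiff ℝ 1 (⇑(henonList l))^[n] := by
  induction n with
  | zero => exact contDiff_id
  | succ n ih => exact ih.comp (contDiff_henonList l)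

theorem mem_setKMinus_iff {g : Equiv.Perm (ℂ × ℂ)} {p : ℂ × ℂ} :
    p ∈ setKMinus g ↔ Bornology.IsBounded (Set.range fun n : ℕ => (⇑g.symm)^[n] p) :=
  Iff.rfl

theorem symm_apply_mem_setKMinus {g : Equiv.Perm (ℂ × ℂ)} {p : ℂ × ℂ} (hp : p ∈ setKMinus g) :
    g.symm p ∈ setKMinus g := by
  refine Bornology.IsBounded.subset (mem_setKMinus_iff.1 hp) ?_
  rintro _ ⟨n, rfl⟩
  exact ⟨n + 1, Function.iterate_succ_apply _ _ _⟩

theorem iterate_symm_mem_setKMinus {g : Equiv.Perm (ℂ × ℂ)} {p : ℂ × ℂ} (hp : p ∈ setKMinus g)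
    (n : ℕ) : (⇑g.symm)^[n] p ∈ setKMinus g := by
  induction n with
  | zero => exact hp
  | succ n ih =>
    rw [Function.iterate_succ_apply']
    exact symm_apply_mem_setKMinus ih

theorem notMem_escapeBackward_of_mem_setKMinus (hR : 0 < R) (hl0 : l ≠ [])
    (hl : ∀ x ∈ l, HenonBounds R L x) {p : ℂ × ℂ} (hp : p ∈ setKMinus (henonList l)) :
    p ∉ escapeBackward R := by
  intro hpe
  have key : ∀ n : ℕ, (⇑(henonList l).symm)^[n] p ∈ escapeBackward R ∧
      2 ^ n * R ≤ ‖((⇑(henonList l).symm)^[n] p).1‖ := by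
    intro n
    induction n with
    | zero => exact ⟨hpe, by simpa using hpe.1.le⟩
    | succ n ih =>
      rw [Function.iterate_succ_apply']
      obtain ⟨h1, h2⟩ := henonList_backward hl ih.1
      refine ⟨h1, le_trans ?_ h2⟩
      have h3 : (2 : ℝ) ≤ 2 ^ l.length :=
        le_self_pow₀ one_le_two (by simpa using hl0)
      rw [pow_succ', mul_assoc]
      exact mul_le_mul h3 ih.2 (by positivity) (by positivity)
  obtain ⟨M, hM⟩ := isBounded_iff_forall_norm_le.1 (mem_setKMinus_iff.1 hp)
  obtain ⟨n, hn⟩ := pow_unbounded_of_one_lt (M / R) (one_lt_two (α := ℝ))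
  have h1 := hM _ ⟨n, rfl⟩
  have h2 := (key n).2.trans ((norm_fst_le _).trans h1)
  rw [div_lt_iff₀ hR] at hn
  linarith

/-- Otherwise the backward orbit stays in `escapeForward R`, where each backward step at least
halves the second coordinate, although it must exceed `R`. -/
theorem exists_iterate_symm_mem_bidisc (hR : 0 < R) (hl0 : l ≠ [])
    (hl : ∀ x ∈ l, HenonBounds R L x) {p : ℂ × ℂ} (hp : p ∈ setKMinus (henonList l)) :
    ∃ n : ℕ, (⇑(henonList l).symm)^[n] p ∈ bidisc R := by
  by_contra! hcon
  have hV : ∀ n : ℕ, (⇑(henonList l).symm)^[n] p ∈ escapeForward R := fun n =>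
    ((mem_bidisc_or_escape R _).resolve_left (hcon n)).resolve_right
      (notMem_escapeBackward_of_mem_setKMinus hR hl0 hl (iterate_symm_mem_setKMinus hp n))
  have key : ∀ n : ℕ, 2 ^ n * ‖((⇑(henonList l).symm)^[n] p).2‖ ≤ ‖p.2‖ := by
    intro n
    induction n with
    | zero => simp
    | succ n ih =>
      refine le_trans ?_ ih
      have h := (henonList_forward hl (hV (n + 1))).2
      rw [Function.iterate_succ_apply', Equiv.apply_symm_apply, ← Function.iterate_succ_apply'
        (⇑(henonList l).symm)] at h
      have h3 : (2 : ℝ) ≤ 2 ^ l.length :=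
        le_self_pow₀ one_le_two (by simpa using hl0)
      rw [pow_succ, mul_assoc]
      gcongr
      exact (mul_le_mul_of_nonneg_right h3 (norm_nonneg _)).trans h
  obtain ⟨n, hn⟩ := pow_unbounded_of_one_lt (‖p.2‖ / R) (one_lt_two (α := ℝ))
  rw [div_lt_iff₀ hR] at hn
  have h1 := mul_le_mul_of_nonneg_left (hV n).1.le (by positivity : (0 : ℝ) ≤ 2 ^ n)
  linarith [key n]

theorem dimH_setKMinus_henonList_le {s : ℝ} (hs : 0 < s) (hR : 0 < R) (hL : 0 ≤ L) (hl0 : l ≠ [])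
    (hl : ∀ x ∈ l, HenonBounds R L x)
    (hsmall : (25 * (L + 1) ^ s) ^ l.length *
      ‖(l.map fun x => (x.1 : ℂ)).prod‖ ^ (s - 2) < 1) :
    dimH (setKMinus (henonList l)) ≤ ENNReal.ofReal s := by
  set g := henonList l with hg
  set W := setKMinus g ∩ bidisc R with hW
  have hWsymm : ∀ p ∈ W, g.symm p ∈ W := by
    intro p hp
    have hK := symm_apply_mem_setKMinus hp.1
    refine ⟨hK, ?_⟩
    rcases mem_bidisc_or_escape R (g.symm p) with h | h | h
    · exact h
    · have := (henonList_forward hl h).1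
      rw [← hg, Equiv.apply_symm_apply] at this
      exact absurd this (disjoint_bidisc_escapeForward hp.2)
    · exact absurd h (notMem_escapeBackward_of_mem_setKMinus hR hl0 hl hK)
  set A := g.symm '' W with hA
  have hAW : A ⊆ W := by rintro _ ⟨p, hp, rfl⟩; exact hWsymm p hp
  have hgA : g '' A = W := by rw [hA, ← Set.image_comp]; simp
  have hzero : hausdorffContent (ℂ × ℂ) s hs W = 0 := by
    have h1 := hausdorffContent_henonList_image_le hs hL hl (A := A)
      (hAW.trans Set.inter_subset_right) (by rw [← hg, hgA]; exact Set.inter_subset_right)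
    rw [← hg, hgA] at h1
    by_contra hne
    -- Finiteness is automatic for the content of a bounded set, unlike for Hausdorff measure.
    have hfin : hausdorffContent (ℂ × ℂ) s hs W ≠ ∞ :=
      ((hausdorffContent_le_ediam_rpow hs W).trans_lt (ENNReal.rpow_lt_top_of_nonneg hs.le
        ((isBounded_bidisc R).subset Set.inter_subset_right).ediam_ne_top)).ne
    have h2 := h1.trans (mul_le_mul_right (measure_mono hAW) _)
    refine h2.not_gt ?_
    conv_rhs => rw [← one_mul (hausdorffContent (ℂ × ℂ) s hs W)]
    exact ENNReal.mul_lt_mul_left hne hfin (by simpa using hsmall)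
  have hdimW := dimH_le_of_hausdorffContent_eq_zero hs hzero
  have hcov : setKMinus g ⊆ ⋃ n : ℕ, (⇑g)^[n] '' W := by
    intro p hp
    obtain ⟨n, hn⟩ := exists_iterate_symm_mem_bidisc hR hl0 hl hp
    refine Set.mem_iUnion.2 ⟨n, _, ⟨iterate_symm_mem_setKMinus hp n, hn⟩, ?_⟩
    exact (Function.LeftInverse.iterate g.apply_symm_apply n) p
  refine (dimH_mono hcov).trans ?_
  rw [dimH_iUnion]
  refine iSup_le fun n => le_trans ?_ hdimW
  exact (contDiff_iterate_henonList l n).contDiffOn.dimH_image_le convex_univ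
    (Set.subset_univ _)

end Dynamics

/-! ### Uniform bounds for the polynomial family -/

/-- A polynomial of degree `d ≥ 2` with bounded coefficients and leading coefficient bounded away
from zero expands by a factor of three outside a disc of explicit radius. -/
theorem three_mul_norm_le_norm_eval {Q : ℂ[X]} {d : ℕ} (hd : 2 ≤ d) (hQ : Q.natDegree = d)
    {M β : ℝ} (hβ : 0 < β) (hlead : β ≤ ‖Q.coeff d‖) (hM : ∀ j, ‖Q.coeff j‖ ≤ M)
    {w : ℂ} (hw1 : 1 ≤ ‖w‖) (hw : (M * d + 3) / β ≤ ‖w‖) : 3 * ‖w‖ ≤ ‖Q.eval w‖ := by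
  obtain ⟨e, rfl⟩ : ∃ e, d = e + 2 := ⟨d - 2, by omega⟩
  have hM0 : 0 ≤ M := (norm_nonneg _).trans (hM 0)
  have hsum : ‖∑ j ∈ Finset.range (e + 2), Q.coeff j * w ^ j‖ ≤
      (e + 2 : ℕ) * (M * ‖w‖ ^ (e + 1)) := by
    refine (norm_sum_le_of_le _ (f := fun j => Q.coeff j * w ^ j)
      (n := fun _ => M * ‖w‖ ^ (e + 1)) fun j hj => ?_).trans (by simp)
    rw [norm_mul, norm_pow]
    gcongr
    · exact hM j
    · exact Nat.lt_succ_iff.1 (Finset.mem_range.1 hj)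
  have heval : Q.eval w = Q.coeff (e + 2) * w ^ (e + 2) +
      ∑ j ∈ Finset.range (e + 2), Q.coeff j * w ^ j := by
    rw [Polynomial.eval_eq_sum_range' (n := e + 3) (by omega), Finset.sum_range_succ, add_comm]
  have h1 := norm_sub_le_norm_add (Q.coeff (e + 2) * w ^ (e + 2))
    (∑ j ∈ Finset.range (e + 2), Q.coeff j * w ^ j)
  rw [← heval, norm_mul, norm_pow] at h1
  have h2 : β * ‖w‖ ^ (e + 2) ≤ ‖Q.coeff (e + 2)‖ * ‖w‖ ^ (e + 2) := by gcongr
  have h3 : M * (e + 2 : ℕ) + 3 ≤ ‖w‖ * β := (div_le_iff₀ hβ).1 hw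
  have h4 : ‖w‖ ≤ ‖w‖ ^ (e + 1) := le_self_pow₀ hw1 (by omega)
  -- The radius is chosen so that the leading term exceeds the d lower terms by 3‖w‖^(d-1).
  have h5 : 3 * ‖w‖ ^ (e + 1) ≤ β * ‖w‖ ^ (e + 2) - (e + 2 : ℕ) * (M * ‖w‖ ^ (e + 1)) := by
    have : 0 ≤ (‖w‖ * β - M * (e + 2 : ℕ) - 3) * ‖w‖ ^ (e + 1) :=
      mul_nonneg (by linarith) (by positivity)
    rw [pow_succ ‖w‖ (e + 1)]
    linarith
  linarith

theorem norm_pow_sub_pow_le_mul {w w' : ℂ} {R : ℝ} (hw : ‖w‖ ≤ R) (hw' : ‖w'‖ ≤ R) (j : ℕ) :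
    ‖w ^ j - w' ^ j‖ ≤ j * R ^ (j - 1) * ‖w - w'‖ := by
  have hR : 0 ≤ R := (norm_nonneg _).trans hw
  rw [← Commute.geom_sum₂_mul (Commute.all w w'), norm_mul]
  gcongr
  refine (norm_sum_le_of_le _ (n := fun _ => R ^ (j - 1)) fun i hi => ?_).trans (by simp)
  have hij : j - 1 = i + (j - 1 - i) := by have := Finset.mem_range.1 hi; omega
  rw [norm_mul, norm_pow, norm_pow]
  conv_rhs => rw [hij, pow_add]
  gcongr

theorem norm_eval_sub_eval_le {Q : ℂ[X]} {d : ℕ} (hQ : Q.natDegree = d) {M R : ℝ}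
    (hM : ∀ j, ‖Q.coeff j‖ ≤ M) {w w' : ℂ} (hw : ‖w‖ ≤ R) (hw' : ‖w'‖ ≤ R) :
    ‖Q.eval w - Q.eval w'‖ ≤ (∑ j ∈ Finset.range (d + 1), M * (j * R ^ (j - 1))) * ‖w - w'‖ := by
  rw [Polynomial.eval_eq_sum_range' (n := d + 1) (by omega),
    Polynomial.eval_eq_sum_range' (n := d + 1) (by omega), ← Finset.sum_sub_distrib,
    Finset.sum_mul]
  refine norm_sum_le_of_le _ fun j _ => ?_
  rw [← mul_sub, norm_mul, mul_assoc]
  have hM0 : 0 ≤ M := (norm_nonneg _).trans (hM 0)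
  gcongr
  · exact hM j
  · exact norm_pow_sub_pow_le_mul hw hw' j

/-- Uniform coefficient bounds for a continuous family of polynomials of constant degree over a
compact set. -/
theorem exists_coeff_bounds {Y : Type*} [TopologicalSpace Y] {K : Set Y} (hK : IsCompact K)
    {Q : Y → ℂ[X]} {d : ℕ} (hQ : ∀ c ∈ K, (Q c).natDegree = d) (hd : d ≠ 0)
    (hcont : ∀ j : ℕ, ContinuousOn (fun c => (Q c).coeff j) K) :
    ∃ M β : ℝ, 0 < β ∧ ∀ c ∈ K, β ≤ ‖(Q c).coeff d‖ ∧ ∀ j, ‖(Q c).coeff j‖ ≤ M := by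
  rcases K.eq_empty_or_nonempty with rfl | hne
  · exact ⟨0, 1, one_pos, by simp⟩
  obtain ⟨c₀, hc₀, hmin⟩ := hK.exists_isMinOn hne (hcont d).norm
  have hb : ∀ j, ∃ B, ∀ c ∈ K, ‖(Q c).coeff j‖ ≤ B := fun j =>
    hK.exists_bound_of_continuousOn (hcont j)
  choose B hB using hb
  refine ⟨∑ j ∈ Finset.range (d + 1), B j, ‖(Q c₀).coeff d‖, ?_, fun c hc => ⟨hmin hc, fun j => ?_⟩⟩
  · rw [norm_pos_iff, ← hQ c₀ hc₀, Polynomial.coeff_natDegree, Polynomial.leadingCoeff_ne_zero]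
    rintro h
    exact hd (by rw [← hQ c₀ hc₀, h, Polynomial.natDegree_zero])
  · have hB0 : ∀ i, 0 ≤ B i := fun i => (norm_nonneg _).trans (hB i c hc)
    by_cases hj : j ≤ d
    · exact (hB j c hc).trans (Finset.single_le_sum (f := B) (fun i _ => hB0 i)
        (Finset.mem_range.2 (by omega)))
    · rw [Polynomial.coeff_eq_zero_of_natDegree_lt (by rw [hQ c hc]; omega), norm_zero]
      exact Finset.sum_nonneg fun i _ => hB0 i

/-- `R` and `L` depend on neither `a` nor `c`; this gives the uniformity of the final threshold. -/
theorem exists_henonBounds {m : ℕ} {d : Fin m → ℕ} (hd : ∀ i, 2 ≤ d i)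
    {Y : Fin m → Type*} [∀ i, TopologicalSpace (Y i)] {C : (i : Fin m) → Set (Y i)}
    (hC : ∀ i, IsCompact (C i)) {P : (i : Fin m) → Y i → ℂ[X]}
    (hdeg : ∀ i, ∀ c ∈ C i, (P i c).natDegree = d i)
    (hcont : ∀ i, ∀ j : ℕ, ContinuousOn (fun c => (P i c).coeff j) (C i)) :
    ∃ R L : ℝ, 0 < R ∧ 0 ≤ L ∧ ∀ a : ℂˣ, ‖(a : ℂ)‖ ≤ 1 → ∀ i, ∀ c ∈ C i,
      HenonBounds R L (a, P i c) := by
  choose M β hβ hMβ using fun i =>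
    exists_coeff_bounds (hC i) (hdeg i) (by have := hd i; omega) (hcont i)
  obtain ⟨R, hR⟩ := (Set.finite_range fun i => (M i * d i + 3) / β i).bddAbove
  obtain ⟨L, hL⟩ := (Set.finite_range fun i =>
    ∑ j ∈ Finset.range (d i + 1), M i * (j * max R 1 ^ (j - 1))).bddAbove
  refine ⟨max R 1, max L 0, by positivity, by positivity, fun a ha i c hc => ⟨ha, ?_, ?_⟩⟩
  · intro w hw
    exact three_mul_norm_le_norm_eval (hd i) (hdeg i c hc) (hβ i) (hMβ i c hc).1 (hMβ i c hc).2
      ((le_max_right _ _).trans hw) ((hR ⟨i, rfl⟩).trans ((le_max_left _ _).trans hw))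
  · intro w w' hw hw'
    refine (norm_eval_sub_eval_le (hdeg i c hc) (hMβ i c hc).2 hw hw').trans ?_
    gcongr
    exact (hL ⟨i, rfl⟩).trans (le_max_left _ _)

end HenonDimension

/-! ### The main theorem -/

theorem proposition5p3 (m : ℕ) (hm : 1 ≤ m)
    (d : Fin m → ℕ) (hd : ∀ i, 2 ≤ d i)
    (k : Fin m → ℕ) (C : (i : Fin m) → Set (Fin (k i) → ℂ))
    (hC : IsCompact (Set.univ.pi C))
    (P : (i : Fin m) → (Fin (k i) → ℂ) → ℂ[X])
    (hdeg : ∀ i, ∀ c ∈ C i, (P i c).natDegree = d i)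
    (hcont : ∀ i, ∀ j : ℕ, ContinuousOn (fun c => (P i c).coeff j) (C i))
    (ε : ℝ) (hε : 0 < ε) :
    ∃ a₀ : ℝ, 0 < a₀ ∧
      ∀ a : Fin m → ℂˣ, (∀ i, ‖(a i : ℂ)‖ < 1) → ‖∏ i, (a i : ℂ)‖ < a₀ →
        ∀ c ∈ Set.univ.pi C,
          dimH (setKMinus (genHenonComp a fun i => P i (c i))) < 2 + ENNReal.ofReal ε := by
  -- Compactness of the product passes to the factors only if it is nonempty.
  rcases (Set.univ.pi C).eq_empty_or_nonempty with hempty | hne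
  · exact ⟨1, one_pos, fun a _ _ c hc => by simp [hempty] at hc⟩
  have hCi : ∀ i, IsCompact (C i) := fun i => by
    rw [← Set.eval_image_univ_pi hne]
    exact hC.image (continuous_apply i)
  obtain ⟨R, L, hR, hL, hbd⟩ := exists_henonBounds hd hCi hdeg hcont
  set s : ℝ := 2 + ε / 2 with hs
  have hs0 : 0 < s := by positivity
  set q : ℝ := (25 * (L + 1) ^ s) ^ m with hq
  have hq0 : 0 < q := by positivity
  -- The threshold solves q · a₀^(ε/2) = 1, the break-even point of the contraction factor.
  refine ⟨q⁻¹ ^ (ε / 2)⁻¹, by positivity, fun a ha hsmall c hc => ?_⟩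
  set l : List (ℂˣ × ℂ[X]) := List.ofFn fun i => (a i, P i (c i)) with hldef
  have hg : genHenonComp a (fun i => P i (c i)) = henonList l := by
    rw [genHenonComp, henonList, hldef, List.map_ofFn]
    rfl
  have hprod : (l.map fun x => (x.1 : ℂ)).prod = ∏ i, (a i : ℂ) := by
    rw [hldef, List.map_ofFn, List.prod_ofFn]
    rfl
  have hlen : l.length = m := List.length_ofFn
  rw [hg]
  refine (dimH_setKMinus_henonList_le (R := R) hs0 hR hL ?_ ?_ ?_).trans_lt ?_
  · rw [Ne, ← List.length_eq_zero_iff, hlen]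
    omega
  · intro x hx
    obtain ⟨i, rfl⟩ := (List.mem_ofFn' _ _).1 hx
    exact hbd (a i) (ha i).le i (c i) (hc i (Set.mem_univ i))
  · rw [hprod, hlen, ← hq, show s - 2 = ε / 2 by rw [hs]; ring, mul_comm, ← lt_div_iff₀ hq0,
      one_div]
    exact (Real.lt_rpow_inv_iff_of_pos (norm_nonneg _) (by positivity) (by positivity)).1 hsmall
  · rw [hs, ENNReal.ofReal_add (by norm_num) (by positivity), ENNReal.ofReal_ofNat]
    exact ENNReal.add_lt_add_left (by simp) ((ENNReal.ofReal_lt_ofReal_iff hε).2 (by linarith))
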